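/- For $d\ge 1$, an open set $U\subseteq\mathbb R^d$ and $f\in L^1(U)$, let $$\mathrm{TV}(f;U)=\sup\Big\{\int_U f(x)\,\mathrm{div}\,\phi(x)\,dx \;:\; \phi\in C_c^\infty(U;\mathbb R^d),\ \|\phi(x)\|_\infty\le 1 \text{ for all } x\in U\Big\}$$ be the (anisotropic) total variation of $f$, and let $\mathrm{BV}(U)$ be the set of $f\in L^1(U)$ with $\mathrm{TV}(f;U)<\infty$. A function $g$ of one real variable is approximately continuous at $z$ if for every $\varepsilon>0$ the set $\{t:|g(t)-g(z)|\ge\varepsilon\}$ has Lebesgue density $0$ at $z$; write $\mathrm{AC}(g)$ for the set of such points. The essential variation of $g$ on $[a,b]$ is $$\mathrm{TV}(g;[a,b])=\sup\Big\{\sum_{i=1}^m |g(z_i)-g(z_{i+1})| \;:\; a<z_1<\cdots<z_{m+1}<b,\ z_1,\dots,z_{m+1}\in \mathrm{AC}(g)\Big\}\in[0,\infty].$$ Theorem. Let $U\subseteq\mathbb R^d$ be open, bounded and convex, and let $f\in\mathrm{BV}(U)$. For $j=1,\dots,d$ let $(x_j,x_{-j})$ denote the point with $j$-th coordinate $x_j$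 and other coordinates $x_{-j}\in\mathbb R^{d-1}$, let $U_{-j}=\{x_{-j}:(x_j,x_{-j})\in U\text{ for some }x_j\}$, and for $x_{-j}\in U_{-j}$ let $I_{x_{-j}}=[a_{x_{-j}},b_{x_{-j}}]$ with $a_{x_{-j}}=\inf\{x_j:(x_j,x_{-j})\in U\}$ and $b_{x_{-j}}=\sup\{x_j:(x_j,x_{-j})\in U\}$. Then for each $j$ the function $x_{-j}\mapsto \mathrm{TV}\big(f(\cdot,x_{-j});I_{x_{-j}}\big)$ is Lebesgue measurable on $U_{-j}$, and $$\mathrm{TV}(f;U)=\sum_{j=1}^d\int_{U_{-j}}\mathrm{TV}\big(f(\cdot,x_{-j});I_{x_{-j}}\big)\,dx_{-j}.$$ -/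

import Mathlib

open MeasureTheory Set Filter Topology TopologicalSpace
open scoped ENNReal Distributions

noncomputable section

/-- The divergence `∑ j, ∂φ_j/∂x_j` of a vector field `φ` on `ℝ^d`. -/
def divergence {d : ℕ} (φ : (Fin d → ℝ) → (Fin d → ℝ)) (x : Fin d → ℝ) : ℝ :=
  ∑ j : Fin d, fderiv ℝ (fun z => φ z j) x (Pi.single j 1)

/-- The anisotropic measure-theoretic total variation of `f` on an open set `U ⊆ ℝ^d`: the
supremum of `∫_U f div φ` over smooth compactly supported vector fields `φ` on `U` with
`‖φ x‖_∞ ≤ 1` on `U`. The norm on `Fin d → ℝ` is the sup norm. Since `φ = 0` is admissible, the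
supremum is unchanged when negative values of the integral are truncated to `0`. -/
def anisotropicTV {d : ℕ} (f : (Fin d → ℝ) → ℝ) (U : Opens (Fin d → ℝ)) : ℝ≥0∞ :=
  ⨆ φ : {φ : 𝓓(U, Fin d → ℝ) // ∀ x ∈ U, ‖φ x‖ ≤ 1},
    ENNReal.ofReal (∫ x in (U : Set (Fin d → ℝ)), f x * divergence φ.1 x)

/-- `f ∈ BV(U)`: `f` is in `L¹(U)` and has finite total variation. Only the values of `f` on `U`
matter. -/
def IsBV {d : ℕ} (f : (Fin d → ℝ) → ℝ) (U : Opens (Fin d → ℝ)) : Prop :=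
  IntegrableOn f (U : Set (Fin d → ℝ)) volume ∧ anisotropicTV f U < ∞

/-- `g` is approximately continuous at `x`: for every `ε > 0`, the set where `|g - g x| ≥ ε` has
Lebesgue density `0` at `x`. -/
def ApproxContinuousAt (g : ℝ → ℝ) (x : ℝ) : Prop :=
  ∀ ε > 0, Tendsto
    (fun r : ℝ => volume (Metric.closedBall x r ∩ {y | ε ≤ |g y - g x|}) /
      volume (Metric.closedBall x r)) (𝓝[>] 0) (𝓝 0)

/-- The essential variation of `g` on `[a, b]`: the supremum of `∑ |g (z_i) - g (z_{i+1})|` over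
finite increasing sequences of points `a < z_1 < ⋯ < z_{m+1} < b` at which `g` is approximately
continuous. -/
def essVariation (g : ℝ → ℝ) (a b : ℝ) : ℝ≥0∞ :=
  eVariationOn g {z ∈ Ioo a b | ApproxContinuousAt g z}

/-- The slice `{t | (t, y) ∈ U}`, where `(t, y)` has `j`-th coordinate `t` and other
coordinates `y`. -/
def coordSlice {n : ℕ} (U : Set (Fin (n + 1) → ℝ)) (j : Fin (n + 1)) (y : Fin n → ℝ) : Set ℝ :=
  {t | (j.insertNth t y : Fin (n + 1) → ℝ) ∈ U}

/-- The projection `U_{-j}` of `U` that forgets the `j`-th coordinate. -/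
def coordProj {n : ℕ} (U : Set (Fin (n + 1) → ℝ)) (j : Fin (n + 1)) : Set (Fin n → ℝ) :=
  {y | (coordSlice U j y).Nonempty}

/-- The essential variation of `t ↦ f (t, y)` on the closed interval whose endpoints are the
infimum and the supremum of the slice of `U` at `y` in direction `j`. -/
def lineVariation {n : ℕ} (f : (Fin (n + 1) → ℝ) → ℝ) (U : Set (Fin (n + 1) → ℝ))
    (j : Fin (n + 1)) (y : Fin n → ℝ) : ℝ≥0∞ :=
  essVariation (fun t => f (j.insertNth t y)) (sInf (coordSlice U j y)) (sSup (coordSlice U j y))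

end

/-! Both sides are compared with L¹ difference quotients. Since the constraint on `φ` is the sup
norm, its components are independent of one another, and `anisotropicTV` is the sum over `j` of the
dual variations `directionalTV` in the directions `e_j`. It remains to treat one direction `e`.

Let `D h` be `h⁻¹ ∫ |f (x + h e) - f x|` over the points `x` with `x` and `x + h e` in `U`. Then `D
h ≤ directionalTV ≤ liminf D`: the lower bound by testing `f` against segment averages of test
functions (`lintegral_translate_le_directionalTV`), the upper one by replacing `∂φ` with difference
quotients (`directionalTV_le_liminf`). In one variable the essential variation `V` satisfies the
same two bounds (`lintegral_translate_le_essVariation`, `essVariation_le_liminf`).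

By Tonelli, `D h` is the integral over the lines of their one-dimensional quotients `q h y`. On
almost every line `V y = liminf q h y`, which gives measurability. Domination gives `directionalTV ≤
liminf ∫ q ≤ ∫ V`, and Fatou gives `∫ V ≤ liminf ∫ q ≤ directionalTV`. Convexity keeps the averaging
segments in `U` and makes the slices intervals. -/

/-! ### Essential variation and difference quotients on the line. -/

/-- Variation is not decreased by passing to a set over which the graph of `g` is dense. -/
lemma eVariationOn_le_of_graph_dense {g : ℝ → ℝ} {S L : Set ℝ}
    (H : ∀ x ∈ S, ∀ ε > 0, ∃ y ∈ L, |y - x| < ε ∧ |g y - g x| < ε) :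
    eVariationOn g S ≤ eVariationOn g L := by
  refine iSup_le ?_
  rintro ⟨n, u, hu, hS⟩
  have H' : ∀ k : ℕ, ∀ x : S, ∃ y ∈ L, |y - x| < 1 / ((k : ℝ) + 1) ∧
      |g y - g x| < 1 / ((k : ℝ) + 1) := fun k x => H x x.2 _ (by positivity)
  choose p hpL hp hgp using H'
  have hlim : ∀ x : S, Tendsto (fun k => p k x) atTop (𝓝 (x : ℝ)) := fun x => by
    rw [tendsto_iff_dist_tendsto_zero]
    exact squeeze_zero (fun _ => dist_nonneg) (fun k => (hp k x).le)
      tendsto_one_div_add_atTop_nhds_zero_nat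
  have hglim : ∀ x : S, Tendsto (fun k => g (p k x)) atTop (𝓝 (g x)) := fun x => by
    rw [tendsto_iff_dist_tendsto_zero]
    exact squeeze_zero (fun _ => dist_nonneg) (fun k => (hgp k x).le)
      tendsto_one_div_add_atTop_nhds_zero_nat
  let v : ℕ → S := fun i => ⟨u i, hS i⟩
  have hsum : Tendsto (fun k => ∑ i ∈ Finset.range n, edist (g (p k (v (i + 1)))) (g (p k (v i))))
      atTop (𝓝 (∑ i ∈ Finset.range n, edist (g (u (i + 1))) (g (u i)))) :=
    tendsto_finsetSum _ fun i _ => (hglim (v (i + 1))).edist (hglim (v i))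
  refine le_of_tendsto hsum ?_
  -- The approximants depend on the point of `S` and not on its index, so repeated points of `u`
  -- stay equal; distinct ones are eventually in the right order.
  have hmono : ∀ᶠ k in atTop, ∀ i ∈ Finset.range n, p k (v i) ≤ p k (v (i + 1)) := by
    rw [Filter.eventually_all_finset]
    intro i _
    rcases (hu (Nat.le_succ i)).eq_or_lt with h | h
    · have : v i = v (i + 1) := Subtype.ext h
      exact Eventually.of_forall fun k => by rw [this]
    · exact ((hlim (v i)).eventually_lt (hlim (v (i + 1))) h).mono fun k hk => hk.le
  filter_upwards [hmono] with k hk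
  refine eVariationOn.sum_le_of_monotoneOn_Iic (u := fun i => p k (v i)) ?_ fun i _ => hpL _ _
  exact monotoneOn_of_le_succ ordConnected_Iic fun i _ _ hi =>
    hk i (Finset.mem_range.2 (Nat.lt_of_succ_le hi))

/-- At a Lebesgue point the mean of `|g - g x|` over shrinking balls tends to `0`, and Chebyshev's
inequality bounds the density of the exceptional set by `ε⁻¹` times this mean. -/
lemma LocallyIntegrable.ae_approxContinuousAt {g : ℝ → ℝ} (hg : LocallyIntegrable g volume) :
    ∀ᵐ x, ApproxContinuousAt g x := by
  filter_upwards [(Besicovitch.vitaliFamily (volume : Measure ℝ)).ae_tendsto_lintegral_enorm_sub_div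
    hg] with x hx ε hε
  have h1 := hx.comp (Besicovitch.tendsto_filterAt (volume : Measure ℝ) x)
  have h2 := ENNReal.Tendsto.const_mul (a := (ENNReal.ofReal ε)⁻¹) h1
    (Or.inr (by simpa using hε))
  rw [mul_zero] at h2
  refine tendsto_of_tendsto_of_tendsto_of_le_of_le tendsto_const_nhds h2 (fun _ => zero_le) fun r => ?_
  simp only [Function.comp]
  rw [← mul_div_assoc]
  gcongr
  have hm : AEMeasurable (fun y => ‖g y - g x‖ₑ) (volume.restrict (Metric.closedBall x r)) :=
    (hg.aestronglyMeasurable.sub aestronglyMeasurable_const).enorm.restrict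
  rw [← ENNReal.mul_le_iff_le_inv (by simpa using hε) (by simp)]
  refine le_trans (mul_le_mul' le_rfl ?_) (mul_meas_ge_le_lintegral₀ hm (ENNReal.ofReal ε))
  rw [inter_comm]
  refine (Measure.le_restrict_apply _ _).trans (measure_mono fun y hy => ?_)
  simp only [mem_ofPred_eq] at hy ⊢
  rw [Real.enorm_eq_ofReal_abs]
  exact ENNReal.ofReal_le_ofReal hy

lemma ApproxContinuousAt.congr {g g' : ℝ → ℝ} {x : ℝ} (h : ApproxContinuousAt g x)
    (hgg' : g =ᶠ[𝓝 x] g') : ApproxContinuousAt g' x := by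
  intro ε hε
  refine (h ε hε).congr' ?_
  obtain ⟨δ, hδ, hb⟩ := Metric.eventually_nhds_iff_ball.1 hgg'
  have : ∀ᶠ r in 𝓝[>] (0 : ℝ), r < δ := nhdsWithin_le_nhds (Iio_mem_nhds hδ)
  filter_upwards [this] with r hr
  congr 2
  ext y
  simp only [mem_inter_iff, mem_ofPred_eq]
  refine and_congr_right fun hy => ?_
  rw [hb y (Metric.closedBall_subset_ball hr hy), hb x (Metric.mem_ball_self hδ)]

lemma ae_Ioo_approxContinuousAt {g : ℝ → ℝ} {a b : ℝ} (hg : IntegrableOn g (Ioo a b)) :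
    ∀ᵐ x, x ∈ Ioo a b → ApproxContinuousAt g x := by
  have hG : Integrable ((Ioo a b).indicator g) volume :=
    (integrable_indicator_iff measurableSet_Ioo).2 hg
  filter_upwards [LocallyIntegrable.ae_approxContinuousAt hG.locallyIntegrable] with x hx hxI
  refine hx.congr ?_
  filter_upwards [isOpen_Ioo.mem_nhds hxI] with y hy
  exact indicator_of_mem hy g

/-- In every neighbourhood of a point of approximate continuity, a set of full measure contains
points at which `g` takes nearby values. -/
lemma ApproxContinuousAt.exists_mem_near {g : ℝ → ℝ} {x a b : ℝ} {P : ℝ → Prop}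
    (h : ApproxContinuousAt g x) (hx : x ∈ Ioo a b) (hP : ∀ᵐ y, y ∈ Ioo a b → P y)
    {ε : ℝ} (hε : 0 < ε) : ∃ y ∈ Ioo a b, P y ∧ |y - x| < ε ∧ |g y - g x| < ε := by
  have h1 := (h ε hε).eventually (gt_mem_nhds (zero_lt_one))
  obtain ⟨δ, hδ, hb⟩ := Metric.isOpen_iff.1 (isOpen_Ioo (a := a) (b := b)) x hx
  have h2 : ∀ᶠ r in 𝓝[>] (0 : ℝ), r < δ := nhdsWithin_le_nhds (Iio_mem_nhds hδ)
  have h3 : ∀ᶠ r in 𝓝[>] (0 : ℝ), r < ε := nhdsWithin_le_nhds (Iio_mem_nhds hε)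
  obtain ⟨r, hr1, hrδ, hrε, hr0⟩ := (h1.and (h2.and (h3.and self_mem_nhdsWithin))).exists
  -- Otherwise the exceptional set would fill the ball up to a null set, while its density there is
  -- below `1`.
  by_contra! hcon
  have hball : ∀ᵐ y, y ∈ Metric.closedBall x r →
      y ∈ Metric.closedBall x r ∩ {y | ε ≤ |g y - g x|} := by
    filter_upwards [hP] with y hy hyr
    have hyI := hb (Metric.closedBall_subset_ball hrδ hyr)
    refine ⟨hyr, hcon y hyI (hy hyI) ?_⟩
    exact (Metric.mem_closedBall.1 hyr).trans_lt hrε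
  have hle : volume (Metric.closedBall x r) ≤
      volume (Metric.closedBall x r ∩ {y | ε ≤ |g y - g x|}) := measure_mono_ae hball
  have hpos : 0 < volume (Metric.closedBall x r) := Metric.measure_closedBall_pos _ _ hr0
  have hfin : volume (Metric.closedBall x r) ≠ ∞ := measure_closedBall_lt_top.ne
  have := ENNReal.div_le_div_right hle (volume (Metric.closedBall x r))
  rw [ENNReal.div_self hpos.ne' hfin] at this
  exact absurd hr1 (not_lt.2 this)

/-- With `v t` the variation up to `t`, almost every increment `|g (t + h) - g t|` is at most `v (t
+ h) - v t`. The integral of the latter telescopes, leaving at most the integral of `v ≤ V` over an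
interval of length `h`. -/
lemma lintegral_translate_le_essVariation {g : ℝ → ℝ} {a b h : ℝ} (hh : 0 < h)
    (hg : IntegrableOn g (Ioo a b)) :
    ∫⁻ t in Ioo a (b - h), ‖g (t + h) - g t‖ₑ ≤ ENNReal.ofReal h * essVariation g a b := by
  set S := {z ∈ Ioo a b | ApproxContinuousAt g z} with hS
  set V := essVariation g a b with hV
  rcases eq_or_ne V ∞ with hT | hT
  · rw [hT, ENNReal.mul_top (by simpa using hh)]; exact le_top
  let v : ℝ → ℝ≥0∞ := fun t => eVariationOn g (S ∩ Iic t)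
  have hvV : ∀ t, v t ≤ V := fun t => eVariationOn.mono _ inter_subset_left
  have hvmono : Monotone v := fun s t hst =>
    eVariationOn.mono _ (inter_subset_inter_right _ (Iic_subset_Iic.2 hst))
  have hvm : Measurable v := hvmono.measurable
  have hAC := ae_Ioo_approxContinuousAt hg
  have hAC' : ∀ᵐ t, t + h ∈ Ioo a b → ApproxContinuousAt g (t + h) :=
    (measurePreserving_add_right volume h).quasiMeasurePreserving.ae hAC
  have key : ∀ᵐ t, t ∈ Ioo a (b - h) → ‖g (t + h) - g t‖ₑ + v t ≤ v (t + h) := by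
    filter_upwards [hAC, hAC'] with t h1 h2 ht
    have ht1 : t ∈ Ioo a b := ⟨ht.1, by linarith [ht.2]⟩
    have ht2 : t + h ∈ Ioo a b := ⟨by linarith [ht.1], by linarith [ht.2]⟩
    have hpair : ‖g (t + h) - g t‖ₑ ≤ eVariationOn g (S ∩ Icc t (t + h)) := by
      rw [← edist_eq_enorm_sub]
      exact eVariationOn.edist_le _ ⟨⟨ht2, h2 ht2⟩, by simp [hh.le]⟩ ⟨⟨ht1, h1 ht1⟩, by simp [hh.le]⟩
    calc ‖g (t + h) - g t‖ₑ + v t ≤ eVariationOn g (S ∩ Icc t (t + h)) + v t := by gcongr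
      _ = v t + eVariationOn g (S ∩ Icc t (t + h)) := add_comm _ _
      _ ≤ eVariationOn g ((S ∩ Iic t) ∪ (S ∩ Icc t (t + h))) :=
        eVariationOn.add_le_union _ fun x hx y hy => hx.2.trans hy.2.1
      _ ≤ v (t + h) := eVariationOn.mono _ (union_subset
        (inter_subset_inter_right _ (Iic_subset_Iic.2 (by linarith)))
        (inter_subset_inter_right _ fun x hx => hx.2))
  -- Subtraction in `ℝ≥0∞` is avoided by adding this finite integral to both sides and cancelling it
  -- at the end.
  have hfin : ∫⁻ t in Ioo a (b - h), v t ≠ ∞ := by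
    refine ((lintegral_mono hvV).trans_lt ?_).ne
    rw [lintegral_const, Measure.restrict_apply_univ]
    exact ENNReal.mul_lt_top hT.lt_top measure_Ioo_lt_top
  refine (ENNReal.add_le_add_iff_right hfin).1 ?_
  have hshift : ∫⁻ t in Ioo a (b - h), v (t + h) = ∫⁻ t in Ioo (a + h) b, v t := by
    rw [← lintegral_indicator measurableSet_Ioo, ← lintegral_indicator measurableSet_Ioo,
      ← lintegral_add_right_eq_self ((Ioo (a + h) b).indicator v) h]
    refine lintegral_congr fun t => ?_
    simp only [indicator, mem_Ioo]
    congr 1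
    apply propext
    constructor <;> rintro ⟨_, _⟩ <;> constructor <;> linarith
  calc (∫⁻ t in Ioo a (b - h), ‖g (t + h) - g t‖ₑ) + ∫⁻ t in Ioo a (b - h), v t
      = ∫⁻ t in Ioo a (b - h), (‖g (t + h) - g t‖ₑ + v t) := (lintegral_add_right _ hvm).symm
    _ ≤ ∫⁻ t in Ioo a (b - h), v (t + h) :=
      lintegral_mono_ae ((ae_restrict_iff' measurableSet_Ioo).2 key)
    _ = ∫⁻ t in Ioo (a + h) b, v t := hshift
    _ ≤ ∫⁻ t in Ioo a (b - h) ∪ Ico (b - h) b, v t := by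
      refine lintegral_mono_set fun t ht => ?_
      rcases lt_or_ge t (b - h) with h' | h'
      · exact Or.inl ⟨by linarith [ht.1], h'⟩
      · exact Or.inr ⟨h', ht.2⟩
    _ ≤ (∫⁻ t in Ioo a (b - h), v t) + ∫⁻ t in Ico (b - h) b, v t := lintegral_union_le _ _ _
    _ ≤ (∫⁻ t in Ioo a (b - h), v t) + ∫⁻ t in Ico (b - h) b, V := by
      gcongr with t; exact hvV t
    _ = ENNReal.ofReal h * V + ∫⁻ t in Ioo a (b - h), v t := by
      rw [lintegral_const, Measure.restrict_apply_univ, Real.volume_Ico, sub_sub_cancel, mul_comm,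
        add_comm]

/-- The averages of `g` over `[x, x + h k]` tend to `g x` at almost every `x`, and such points
suffice to compute the variation. A difference of two averages is an integral of difference
quotients over the interval between the points, and these intervals do not overlap. -/
lemma essVariation_le_liminf {g : ℝ → ℝ} {a b : ℝ} (hg : IntegrableOn g (Ioo a b))
    {h : ℕ → ℝ} (hpos : ∀ k, 0 < h k) (hlim : Tendsto h atTop (𝓝 0)) :
    essVariation g a b ≤ liminf (fun k => (ENNReal.ofReal (h k))⁻¹ *
      ∫⁻ t in Ioo a (b - h k), ‖g (t + h k) - g t‖ₑ) atTop := by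
  set G : ℝ → ℝ := (Ioo a b).indicator g with hGdef
  have hG : Integrable G volume := (integrable_indicator_iff measurableSet_Ioo).2 hg
  have hGI : ∀ x y, IntervalIntegrable G volume x y := fun x y => hG.intervalIntegrable
  set L := {x ∈ Ioo a b | HasDerivAt (fun y => ∫ t in (0 : ℝ)..y, G t) (g x) x} with hL
  have hLae : ∀ᵐ x, x ∈ Ioo a b → HasDerivAt (fun y => ∫ t in (0 : ℝ)..y, G t) (g x) x := by
    filter_upwards [_root_.LocallyIntegrable.ae_hasDerivAt_integral hG.locallyIntegrable] with x hx hxI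
    simpa [hGdef, hxI] using hx 0
  have hSL : essVariation g a b ≤ eVariationOn g L :=
    eVariationOn_le_of_graph_dense fun x hx ε hε => by
      obtain ⟨y, hyI, hy, h1, h2⟩ := hx.2.exists_mem_near hx.1 hLae hε
      exact ⟨y, ⟨hyI, hy⟩, h1, h2⟩
  refine hSL.trans (iSup_le ?_)
  rintro ⟨n, u, hu, hus⟩
  let A : ℕ → ℝ → ℝ := fun k x => (h k)⁻¹ * ∫ t in x..(x + h k), G t
  have hA : ∀ x ∈ L, Tendsto (fun k => A k x) atTop (𝓝 (g x)) := by
    intro x hx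
    have h1 := hx.2.tendsto_slope_zero
    have h2 : Tendsto h atTop (𝓝[≠] 0) :=
      tendsto_nhdsWithin_iff.2 ⟨hlim, Eventually.of_forall fun k => (hpos k).ne'⟩
    refine (h1.comp h2).congr fun k => ?_
    simp only [Function.comp, A, smul_eq_mul]
    rw [intervalIntegral.integral_interval_sub_left (hGI _ _) (hGI _ _)]
  have hsum : Tendsto (fun k => ∑ i ∈ Finset.range n, edist (A k (u (i + 1))) (A k (u i)))
      atTop (𝓝 (∑ i ∈ Finset.range n, edist (g (u (i + 1))) (g (u i)))) :=
    tendsto_finsetSum _ fun i _ => (hA _ (hus _)).edist (hA _ (hus _))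
  simp only
  rw [← hsum.liminf_eq]
  refine liminf_le_liminf ?_
  have hub : ∀ᶠ k in atTop, u n + h k < b := by
    have : Tendsto (fun k => u n + h k) atTop (𝓝 (u n + 0)) := tendsto_const_nhds.add hlim
    exact this.eventually_lt_const (by simpa using (hus n).1.2)
  filter_upwards [hub] with k hk
  have hstep : ∀ x y, a < x → x ≤ y → y + h k < b → edist (A k y) (A k x) ≤
      (ENNReal.ofReal (h k))⁻¹ * ∫⁻ t in Ioc x y, ‖g (t + h k) - g t‖ₑ := by
    intro x y hx hxy hy
    have e1 : A k y - A k x = (h k)⁻¹ * ∫ t in x..y, (G (t + h k) - G t) := by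
      have hI1 : IntervalIntegrable (fun t => G (t + h k)) volume x y :=
        (hG.comp_add_right (h k)).intervalIntegrable
      rw [intervalIntegral.integral_sub hI1 (hGI _ _), intervalIntegral.integral_comp_add_right,
        ← mul_sub]
      congr 1
      rw [intervalIntegral.integral_interval_sub_interval_comm (hGI _ _) (hGI _ _) (hGI _ _),
        intervalIntegral.integral_symm x y, intervalIntegral.integral_symm (x + h k) (y + h k)]
      linarith
    rw [edist_eq_enorm_sub, e1, enorm_mul, intervalIntegral.integral_of_le hxy,
      Real.enorm_eq_ofReal (inv_nonneg.2 (hpos k).le), ENNReal.ofReal_inv_of_pos (hpos k)]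
    gcongr
    refine (enorm_integral_le_lintegral_enorm _).trans (le_of_eq ?_)
    refine setLIntegral_congr_fun measurableSet_Ioc fun t ht => ?_
    have h1 : t ∈ Ioo a b := ⟨hx.trans ht.1, by linarith [ht.2, hpos k]⟩
    have h2 : t + h k ∈ Ioo a b := ⟨by linarith [ht.1, hpos k], by linarith [ht.2]⟩
    simp only [hGdef, indicator_of_mem h1, indicator_of_mem h2]
  have hind : ∀ m ≤ n, ∑ i ∈ Finset.range m, edist (A k (u (i + 1))) (A k (u i)) ≤
      (ENNReal.ofReal (h k))⁻¹ * ∫⁻ t in Ioc (u 0) (u m), ‖g (t + h k) - g t‖ₑ := by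
    intro m hm
    induction m with
    | zero => simp
    | succ m ih =>
      rw [Finset.sum_range_succ, ← Ioc_union_Ioc_eq_Ioc (hu (Nat.zero_le m)) (hu (Nat.le_succ m)),
        lintegral_union measurableSet_Ioc (Ioc_disjoint_Ioc_of_le le_rfl), mul_add]
      refine add_le_add (ih (by omega)) (hstep _ _ (hus m).1.1 (hu (Nat.le_succ m)) ?_)
      have := hu hm
      linarith
  refine (hind n le_rfl).trans ?_
  gcongr
  intro t ht
  exact ⟨(hus 0).1.1.trans ht.1, by linarith [ht.2]⟩

/-! ### Directional variation by duality, and its comparison with difference quotients. -/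

section DirectionalVariation

variable {E : Type*} [NormedAddCommGroup E] [NormedSpace ℝ E]

/-- Smooth functions with compact support in `U` and values in `[-1, 1]`. -/
structure IsUnitTestFunction (U : Set E) (φ : E → ℝ) : Prop where
  contDiff : ContDiff ℝ ((⊤ : ℕ∞) : WithTop ℕ∞) φ
  hasCompactSupport : HasCompactSupport φ
  tsupport_subset : tsupport φ ⊆ U
  abs_le_one : ∀ x, |φ x| ≤ 1

namespace IsUnitTestFunction

variable {U : Set E} {φ : E → ℝ}

lemma zero : IsUnitTestFunction U (0 : E → ℝ) where
  contDiff := contDiff_const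
  hasCompactSupport := HasCompactSupport.zero
  tsupport_subset := by simp [tsupport]
  abs_le_one := by simp

lemma neg (hφ : IsUnitTestFunction U φ) : IsUnitTestFunction U (-φ) where
  contDiff := hφ.contDiff.neg
  hasCompactSupport := hφ.hasCompactSupport.neg
  tsupport_subset := by
    have : tsupport (-φ) = tsupport φ := by simp [tsupport, Function.support_neg]
    rw [this]; exact hφ.tsupport_subset
  abs_le_one := by simpa using hφ.abs_le_one

lemma eq_zero_of_notMem (hφ : IsUnitTestFunction U φ) {x : E} (hx : x ∉ U) : φ x = 0 :=
  image_eq_zero_of_notMem_tsupport fun h => hx (hφ.tsupport_subset h)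

lemma mono {W : Set E} (hφ : IsUnitTestFunction U φ) (hW : tsupport φ ⊆ W) :
    IsUnitTestFunction W φ :=
  { hφ with tsupport_subset := hW }

lemma continuous (hφ : IsUnitTestFunction U φ) : Continuous φ := hφ.contDiff.continuous

lemma differentiable (hφ : IsUnitTestFunction U φ) : Differentiable ℝ φ :=
  hφ.contDiff.differentiable (by simp)

lemma continuous_fderiv_apply (hφ : IsUnitTestFunction U φ) (e : E) :
    Continuous fun x => fderiv ℝ φ x e :=
  (hφ.contDiff.continuous_fderiv (by simp)).clm_apply continuous_const

lemma exists_fderiv_bound (hφ : IsUnitTestFunction U φ) :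
    ∃ C, ∀ x, ‖fderiv ℝ φ x‖ ≤ C :=
  (hφ.hasCompactSupport.fderiv ℝ).exists_bound_of_continuous
    (hφ.contDiff.continuous_fderiv (by simp))

lemma exists_lipschitz (hφ : IsUnitTestFunction U φ) :
    ∃ C : ℝ, ∀ x y, |φ x - φ y| ≤ C * ‖x - y‖ := by
  obtain ⟨C, hC⟩ := hφ.exists_fderiv_bound
  exact ⟨C, fun x y => convex_univ.norm_image_sub_le_of_norm_fderiv_le
    (fun z _ => hφ.differentiable z) (fun z _ => hC z) (mem_univ y) (mem_univ x)⟩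

end IsUnitTestFunction

/-- The average of a test function over the segment `[x - h • e, x]`. -/
lemma IsUnitTestFunction.exists_average {U W : Set E} (hU : Convex ℝ U) {h : ℝ} (hh : 0 < h)
    {e : E} (hW : W ⊆ {x | x ∈ U ∧ x + h • e ∈ U}) {ψ : E → ℝ} (hψ : IsUnitTestFunction W ψ) :
    ∃ Ψ : E → ℝ, IsUnitTestFunction U Ψ ∧
      ∀ x, fderiv ℝ Ψ x e = h⁻¹ * (ψ x - ψ (x - h • e)) := by
  borelize E
  -- As a convolution of `ψ` with a finite measure carried by the segment, the integral inherits the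
  -- smoothness of `ψ`.
  let ν : Measure E := (volume.restrict (Ioc (0 : ℝ) h)).map (fun s => s • e)
  have : IsFiniteMeasure ν := by dsimp only [ν]; infer_instance
  let Φ : E → ℝ := MeasureTheory.convolution (fun _ => (1 : ℝ)) ψ (ContinuousLinearMap.lsmul ℝ ℝ) ν
  have hΦeq : ∀ x, Φ x = ∫ s in (0 : ℝ)..h, ψ (x - s • e) := by
    intro x
    have hm : AEMeasurable (fun s : ℝ => s • e) (volume.restrict (Ioc (0 : ℝ) h)) :=
      (by fun_prop : Continuous fun s : ℝ => s • e).measurable.aemeasurable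
    have hc : Continuous fun t : E => ψ (x - t) := hψ.continuous.comp (by fun_prop)
    simp only [Φ, MeasureTheory.convolution_def, ContinuousLinearMap.lsmul_apply, one_smul]
    rw [intervalIntegral.integral_of_le hh.le, integral_map hm]
    exact hc.measurable.aestronglyMeasurable
  have hΦsmooth : ContDiff ℝ ((⊤ : ℕ∞) : WithTop ℕ∞) Φ :=
    hψ.hasCompactSupport.contDiff_convolution_right _
      (integrable_const (1 : ℝ)).locallyIntegrable hψ.contDiff
  have hΦderiv : ∀ x, fderiv ℝ Φ x e = ψ x - ψ (x - h • e) := by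
    intro x
    have h1 : HasDerivAt (fun t : ℝ => Φ (x + t • e)) (fderiv ℝ Φ x e) 0 := by
      have hl : HasDerivAt (fun t : ℝ => x + t • e) e 0 := by
        simpa using ((hasDerivAt_id (0 : ℝ)).smul_const e).const_add x
      have hd : HasFDerivAt Φ (fderiv ℝ Φ x) (x + (0 : ℝ) • e) := by
        simpa using (hΦsmooth.differentiable (by simp) x).hasFDerivAt
      exact hd.comp_hasDerivAt (0 : ℝ) hl
    have hc : Continuous fun u : ℝ => ψ (x + u • e) := hψ.continuous.comp (by fun_prop)
    have h2 : (fun t : ℝ => Φ (x + t • e)) = fun t =>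
        (∫ u in (0 : ℝ)..t, ψ (x + u • e)) - ∫ u in (0 : ℝ)..(t - h), ψ (x + u • e) := by
      funext t
      rw [hΦeq, intervalIntegral.integral_interval_sub_left (hc.intervalIntegrable _ _)
        (hc.intervalIntegrable _ _)]
      have := intervalIntegral.integral_comp_sub_left (a := 0) (b := h)
        (fun u : ℝ => ψ (x + u • e)) t
      rw [sub_zero] at this
      rw [← this]
      refine intervalIntegral.integral_congr fun s _ => ?_
      simp only [sub_smul, add_sub_assoc]
    have h3 : HasDerivAt (fun t : ℝ => Φ (x + t • e)) (ψ x - ψ (x - h • e)) 0 := by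
      rw [h2]
      have hd1 := (hc.integral_hasStrictDerivAt 0 0).hasDerivAt
      have hd2 : HasDerivAt (fun t : ℝ => ∫ u in (0 : ℝ)..(t - h), ψ (x + u • e))
          (ψ (x + (0 - h) • e)) 0 :=
        HasDerivAt.comp_sub_const (0 : ℝ) h (hc.integral_hasStrictDerivAt 0 (0 - h)).hasDerivAt
      have hd := hd1.sub hd2
      simp only [zero_smul, add_zero, zero_sub, neg_smul, ← sub_eq_add_neg] at hd
      exact hd
    exact h1.unique h3
  have hΦbound : ∀ x, |Φ x| ≤ h := by
    intro x
    rw [hΦeq]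
    have := intervalIntegral.norm_integral_le_of_norm_le_const (a := 0) (b := h) (C := 1)
      (f := fun s => ψ (x - s • e)) fun s _ => hψ.abs_le_one _
    simpa [abs_of_pos hh] using this
  -- The segments from `x` to `x + h • e` with `x` in the support of `ψ`. Their union is compact,
  -- and convexity puts it inside `U`.
  let K : Set E := (fun p : E × ℝ => p.1 + p.2 • e) '' (tsupport ψ ×ˢ Icc 0 h)
  have hK : IsCompact K := (hψ.hasCompactSupport.isCompact.prod isCompact_Icc).image (by fun_prop)
  have hKU : K ⊆ U := by
    rintro _ ⟨⟨x, s⟩, ⟨hx, hs⟩, rfl⟩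
    obtain ⟨hx1, hx2⟩ := hW (hψ.tsupport_subset hx)
    have := hU.add_smul_mem hx1 hx2 (t := s / h)
      ⟨div_nonneg hs.1 hh.le, div_le_one_of_le₀ hs.2 hh.le⟩
    rwa [smul_smul, div_mul_cancel₀ _ hh.ne'] at this
  have hsupp : Function.support Φ ⊆ K := by
    intro x hx
    by_contra hxK
    refine hx ?_
    rw [hΦeq, intervalIntegral.integral_of_le hh.le]
    refine setIntegral_eq_zero_of_forall_eq_zero fun s hs => ?_
    refine image_eq_zero_of_notMem_tsupport fun hmem => hxK ?_
    exact ⟨(x - s • e, s), ⟨hmem, ⟨hs.1.le, hs.2⟩⟩, by simp⟩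
  have htsupp : tsupport Φ ⊆ K := closure_minimal hsupp hK.isClosed
  refine ⟨fun x => h⁻¹ * Φ x, ⟨contDiff_const.mul hΦsmooth, ?_, ?_, ?_⟩, fun x => ?_⟩
  · have hc : HasCompactSupport Φ := hK.of_isClosed_subset (isClosed_tsupport _) htsupp
    exact hc.mul_left
  · exact (closure_mono (Function.support_mul_subset_right _ _)).trans (htsupp.trans hKU)
  · intro x
    rw [abs_mul, abs_of_pos (inv_pos.2 hh), inv_mul_le_iff₀ hh, mul_one]
    exact hΦbound x
  · rw [fderiv_const_mul (hΦsmooth.differentiable (by simp) x)]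
    simp [hΦderiv x]

variable [MeasurableSpace E] [BorelSpace E] (μ : Measure E)

/-- Summation by parts for difference quotients against a test function. -/
lemma IsUnitTestFunction.setIntegral_mul_sub_translate [μ.IsAddRightInvariant] {U : Set E}
    (hUo : MeasurableSet U) {f : E → ℝ} (hf : IntegrableOn f U μ) {v : E} {ψ : E → ℝ}
    (hψ : IsUnitTestFunction {x | x ∈ U ∧ x + v ∈ U} ψ) :
    ∫ x in U, f x * (ψ x - ψ (x - v)) ∂μ =
      -∫ x in {x | x ∈ U ∧ x + v ∈ U}, (f (x + v) - f x) * ψ x ∂μ := by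
  set f₀ := U.indicator f with hf₀
  have hfi : Integrable f₀ μ := (integrable_indicator_iff hUo).2 hf
  have hWm : MeasurableSet {x | x ∈ U ∧ x + v ∈ U} :=
    hUo.inter ((continuous_add_const v).measurable hUo)
  have hψb : ∀ x, ‖ψ x‖ ≤ 1 := hψ.abs_le_one
  have i1 : Integrable (fun x => f₀ x * ψ x) μ :=
    hfi.mul_bdd hψ.continuous.measurable.aestronglyMeasurable (ae_of_all _ hψb)
  have i2 : Integrable (fun x => f₀ x * ψ (x - v)) μ :=
    hfi.mul_bdd (hψ.continuous.comp (continuous_sub_right v)).measurable.aestronglyMeasurable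
      (ae_of_all _ fun x => hψb _)
  have i3 : Integrable (fun x => f₀ (x + v) * ψ x) μ :=
    (hfi.comp_add_right v).mul_bdd hψ.continuous.measurable.aestronglyMeasurable (ae_of_all _ hψb)
  have e1 : ∫ x in U, f x * (ψ x - ψ (x - v)) ∂μ = ∫ x, (f₀ x * ψ x - f₀ x * ψ (x - v)) ∂μ := by
    rw [← integral_indicator hUo]
    refine integral_congr_ae (ae_of_all _ fun x => ?_)
    by_cases hx : x ∈ U <;> simp [hf₀, hx, mul_sub]
  have e2 : ∫ x, f₀ x * ψ (x - v) ∂μ = ∫ x, f₀ (x + v) * ψ x ∂μ := by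
    rw [← integral_add_right_eq_self _ v]
    simp
  have e3 : ∫ x in {x | x ∈ U ∧ x + v ∈ U}, (f (x + v) - f x) * ψ x ∂μ =
      ∫ x, (f₀ (x + v) * ψ x - f₀ x * ψ x) ∂μ := by
    rw [← integral_indicator hWm]
    refine integral_congr_ae (ae_of_all _ fun x => ?_)
    by_cases hx : x ∈ {x | x ∈ U ∧ x + v ∈ U}
    · simp [hf₀, hx, hx.1, hx.2, sub_mul]
    · simp [indicator_of_notMem hx, hψ.eq_zero_of_notMem hx]
  rw [e1, e3, integral_sub i1 i2, integral_sub i3 i1, e2]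
  ring

/-- The variation of `f` on `U` in the direction `e`, defined by duality. -/
noncomputable def directionalTV (f : E → ℝ) (U : Set E) (e : E) : ℝ≥0∞ :=
  ⨆ φ : {φ : E → ℝ // IsUnitTestFunction U φ},
    ENNReal.ofReal (∫ x in U, f x * fderiv ℝ φ.1 x e ∂μ)

/-- The derivative of a test function is the limit of its backward difference quotients, dominated
by the Lipschitz constant. Summation by parts moves the difference onto `f`, and `|φ| ≤ 1` leaves
the L¹ norm. -/
lemma directionalTV_le_liminf [μ.IsAddRightInvariant] {U : Set E} (hUo : IsOpen U) {f : E → ℝ} (hf : IntegrableOn f U μ)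
    {e : E} {h : ℕ → ℝ} (hpos : ∀ k, 0 < h k) (hlim : Tendsto h atTop (𝓝 0)) :
    directionalTV μ f U e ≤ liminf (fun k => (ENNReal.ofReal (h k))⁻¹ *
      ∫⁻ x in {x | x ∈ U ∧ x + h k • e ∈ U}, ‖f (x + h k • e) - f x‖ₑ ∂μ) atTop := by
  refine iSup_le ?_
  rintro ⟨φ, hφ⟩
  obtain ⟨C, hC⟩ := hφ.exists_lipschitz
  have htend : Tendsto (fun k => ∫ x in U, f x * ((h k)⁻¹ * (φ x - φ (x - h k • e))) ∂μ) atTop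
      (𝓝 (∫ x in U, f x * fderiv ℝ φ x e ∂μ)) := by
    refine tendsto_integral_of_dominated_convergence (fun x => ‖f x‖ * (C * ‖e‖)) (fun k => ?_)
      (hf.norm.mul_const _) (fun k => ae_of_all _ fun x => ?_) (ae_of_all _ fun x => ?_)
    · refine hf.aestronglyMeasurable.mul (Continuous.measurable ?_).aestronglyMeasurable
      exact continuous_const.mul (hφ.continuous.sub (hφ.continuous.comp (by fun_prop)))
    · rw [norm_mul, norm_mul, norm_inv, Real.norm_of_nonneg (hpos k).le]
      refine mul_le_mul_of_nonneg_left ?_ (norm_nonneg _)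
      rw [inv_mul_le_iff₀ (hpos k)]
      refine (hC _ _).trans (le_of_eq ?_)
      rw [sub_sub_cancel, norm_smul, Real.norm_of_nonneg (hpos k).le]
      ring
    · refine Tendsto.const_mul _ ?_
      have hl : HasDerivAt (fun t : ℝ => x - t • e) (-e) 0 := by
        simpa using ((hasDerivAt_id (0 : ℝ)).smul_const e).const_sub x
      have hd : HasFDerivAt φ (fderiv ℝ φ x) (x - (0 : ℝ) • e) := by
        simpa using (hφ.differentiable x).hasFDerivAt
      have h1 := (hd.comp_hasDerivAt (0 : ℝ) hl).neg.tendsto_slope_zero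
      have h2 : Tendsto h atTop (𝓝[≠] 0) :=
        tendsto_nhdsWithin_iff.2 ⟨hlim, Eventually.of_forall fun k => (hpos k).ne'⟩
      have h3 := h1.comp h2
      rw [map_neg, neg_neg] at h3
      refine h3.congr fun k => ?_
      change (h k)⁻¹ * (-φ (x - (0 + h k) • e) - -φ (x - (0 : ℝ) • e)) = _
      rw [zero_add, zero_smul, sub_zero]
      ring
  rw [← (ENNReal.continuous_ofReal.tendsto _ |>.comp htend).liminf_eq]
  refine liminf_le_liminf ?_
  obtain ⟨δ, hδ, hδU⟩ := hφ.hasCompactSupport.isCompact.exists_cthickening_subset_open hUo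
    hφ.tsupport_subset
  have hsmall : ∀ᶠ k in atTop, ‖h k • e‖ < δ := by
    have : Tendsto (fun k => ‖h k • e‖) atTop (𝓝 ‖(0 : ℝ) • e‖) := (hlim.smul_const e).norm
    exact this.eventually_lt_const (by simpa using hδ)
  filter_upwards [hsmall] with k hk
  have hφW : IsUnitTestFunction {x | x ∈ U ∧ x + h k • e ∈ U} φ := hφ.mono fun x hx =>
    ⟨hφ.tsupport_subset hx, hδU (Metric.mem_cthickening_of_dist_le _ x δ _ hx (by simpa using hk.le))⟩
  have heq : ∫ x in U, f x * ((h k)⁻¹ * (φ x - φ (x - h k • e))) ∂μ =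
      (h k)⁻¹ * -∫ x in {x | x ∈ U ∧ x + h k • e ∈ U}, (f (x + h k • e) - f x) * φ x ∂μ := by
    rw [← hφW.setIntegral_mul_sub_translate μ hUo.measurableSet hf, ← integral_const_mul]
    refine integral_congr_ae (ae_of_all _ fun x => ?_)
    simp only
    ring
  simp only [Function.comp]
  rw [heq, ENNReal.ofReal_mul (inv_nonneg.2 (hpos k).le), ENNReal.ofReal_inv_of_pos (hpos k)]
  gcongr
  rw [← integral_neg]
  refine (ENNReal.ofReal_le_ofReal (Real.le_norm_self _)).trans ?_
  rw [ofReal_norm]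
  refine (enorm_integral_le_lintegral_enorm _).trans (lintegral_mono fun x => ?_)
  rw [enorm_neg, enorm_mul]
  refine mul_le_of_le_one_right' ?_
  rw [Real.enorm_eq_ofReal_abs]
  exact ENNReal.ofReal_le_one.2 (hφ.abs_le_one x)

variable [FiniteDimensional ℝ E] [μ.IsAddHaarMeasure]

/-- Mollification: bounded measurable functions vanishing off a compact subset of `W` are pointwise
almost everywhere limits of test functions. -/
lemma exists_seq_isUnitTestFunction_tendsto {K W : Set E} (hK : IsCompact K) (hW : IsOpen W)
    (hKW : K ⊆ W) {s : E → ℝ} (hs : AEStronglyMeasurable s μ) (hs1 : ∀ x, |s x| ≤ 1)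
    (hs0 : ∀ x ∉ K, s x = 0) :
    ∃ ψ : ℕ → E → ℝ, (∀ k, IsUnitTestFunction W (ψ k)) ∧
      ∀ᵐ x ∂μ, Tendsto (fun k => ψ k x) atTop (𝓝 (s x)) := by
  obtain ⟨δ, hδ, hδW⟩ := hK.exists_cthickening_subset_open hW hKW
  -- Radii tending to `0` with `2 * r k ≤ δ`, so that every mollification is supported in the
  -- `δ`-thickening of `K`.
  let r : ℕ → ℝ := fun k => δ / 2 * (1 / ((k : ℝ) + 1))
  have hr : ∀ k, 0 < r k := fun k => by positivity
  let b : ℕ → ContDiffBump (0 : E) := fun k => ⟨r k, 2 * r k, hr k, by linarith [hr k]⟩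
  have hrδ : ∀ k, (b k).rOut ≤ δ := fun k => by
    have : 1 / ((k : ℝ) + 1) ≤ 1 := by
      rw [div_le_one (by positivity)]; linarith [k.cast_nonneg (α := ℝ)]
    change 2 * (δ / 2 * (1 / ((k : ℝ) + 1))) ≤ δ
    nlinarith
  have hsi : Integrable s μ := by
    have : IntegrableOn s K μ :=
      Measure.integrableOn_of_bounded (M := 1) hK.measure_lt_top.ne hs
        (ae_of_all _ fun x => hs1 x)
    exact (integrableOn_iff_integrable_of_support_subset fun x hx => by
      by_contra h; exact hx (hs0 x h)).1 this
  let ψ : ℕ → E → ℝ := fun k =>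
    MeasureTheory.convolution ((b k).normed μ) s (ContinuousLinearMap.lsmul ℝ ℝ) μ
  have hsupp : ∀ k, tsupport (ψ k) ⊆ Metric.cthickening δ K := by
    intro k
    refine closure_minimal ?_ Metric.isClosed_cthickening
    refine (support_convolution_subset _).trans ?_
    rintro _ ⟨y, hy, x, hx, rfl⟩
    have hxK : x ∈ K := by by_contra h; exact hx (hs0 x h)
    rw [(b k).support_normed_eq, mem_ball_zero_iff] at hy
    refine Metric.mem_cthickening_of_dist_le _ x δ K hxK ?_
    simpa using hy.le.trans (hrδ k)
  refine ⟨ψ, fun k => ⟨?_, ?_, (hsupp k).trans hδW, ?_⟩, ?_⟩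
  · exact (b k).hasCompactSupport_normed.contDiff_convolution_left _ (b k).contDiff_normed
      hsi.locallyIntegrable
  · exact hK.cthickening.of_isClosed_subset (isClosed_tsupport _) (hsupp k)
  · intro x
    have := dist_convolution_le (μ := μ) (x₀ := x) (z₀ := (0 : ℝ)) (zero_le_one (α := ℝ))
      (b k).support_normed_eq.subset (b k).nonneg_normed (b k).integral_normed hs
      (fun y _ => by simpa using hs1 y)
    simpa using this
  -- Almost everywhere convergence needs comparable inner and outer radii; their ratio is always
  -- `2`.
  · refine ContDiffBump.ae_convolution_tendsto_right_of_locallyIntegrable (K := 2) ?_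
      (Eventually.of_forall fun k => le_rfl) hsi.locallyIntegrable
    have := (tendsto_one_div_add_atTop_nhds_zero_nat (𝕜 := ℝ)).const_mul (δ / 2)
    simpa [b, r] using this.const_mul 2

/-- The `L¹` norm on an open set is the dual norm against test functions. -/
lemma lintegral_enorm_le_of_forall_isUnitTestFunction {W : Set E} (hW : IsOpen W) {F : E → ℝ}
    (hF : IntegrableOn F W μ) {c : ℝ}
    (H : ∀ ψ, IsUnitTestFunction W ψ → ∫ x in W, F x * ψ x ∂μ ≤ c) :
    ∫⁻ x in W, ‖F x‖ₑ ∂μ ≤ ENNReal.ofReal c := by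
  have hcompact : ∀ K : Set E, IsCompact K → K ⊆ W →
      ∫⁻ x in K, ‖F x‖ₑ ∂μ ≤ ENNReal.ofReal c := by
    intro K hK hKW
    -- The sign of `F` on `K`, equal to `0` where `F` vanishes because division by zero gives zero;
    -- hence `F * s = |F|` on `K`.
    set s : E → ℝ := K.indicator fun x => F x / |F x| with hsdef
    have hs : AEStronglyMeasurable s μ := by
      refine (aestronglyMeasurable_indicator_iff hK.measurableSet).2 ?_
      have hm : AEMeasurable F (μ.restrict K) := (hF.mono_set hKW).aestronglyMeasurable.aemeasurable
      exact (hm.div (measurable_abs.comp_aemeasurable hm)).aestronglyMeasurable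
    have hs1 : ∀ x, |s x| ≤ 1 := by
      intro x
      by_cases hx : x ∈ K
      · simp only [hsdef, indicator_of_mem hx, abs_div, abs_abs]
        exact div_self_le_one _
      · simp [hsdef, indicator_of_notMem hx]
    obtain ⟨ψ, hψ, hlim⟩ := exists_seq_isUnitTestFunction_tendsto μ hK hW hKW hs hs1
      fun x hx => indicator_of_notMem hx _
    have htend : Tendsto (fun k => ∫ x in W, F x * ψ k x ∂μ) atTop
        (𝓝 (∫ x in W, F x * s x ∂μ)) := by
      refine tendsto_integral_of_dominated_convergence (fun x => ‖F x‖) (fun k => ?_) hF.norm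
        (fun k => ae_of_all _ fun x => ?_) ?_
      · exact hF.aestronglyMeasurable.mul (hψ k).continuous.measurable.aestronglyMeasurable
      · rw [norm_mul]
        exact mul_le_of_le_one_right (norm_nonneg _) ((hψ k).abs_le_one x)
      · filter_upwards [ae_restrict_of_ae hlim] with x hx
        exact hx.const_mul _
    have hle : ∫ x in W, F x * s x ∂μ ≤ c := le_of_tendsto' htend fun k => H _ (hψ k)
    have heq : ∫ x in W, F x * s x ∂μ = ∫ x in K, ‖F x‖ ∂μ := by
      have : (fun x => F x * s x) = K.indicator fun x => ‖F x‖ := by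
        funext x
        by_cases hx : x ∈ K
        · simp only [hsdef, indicator_of_mem hx, Real.norm_eq_abs]
          rcases eq_or_ne (F x) 0 with h0 | h0
          · simp [h0]
          · rw [mul_div_assoc', div_eq_iff (abs_ne_zero.2 h0), abs_mul_abs_self]
        · simp [hsdef, indicator_of_notMem hx]
      rw [this, setIntegral_indicator hK.measurableSet, inter_eq_self_of_subset_right hKW]
    rw [← ofReal_integral_norm_eq_lintegral_enorm (hF.mono_set hKW), ← heq]
    exact ENNReal.ofReal_le_ofReal hle
  -- Cutting closed sets that exhaust `W` by balls gives a compact exhaustion.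
  obtain ⟨T, hTc, hTW, hTU, hTm⟩ := hW.exists_iUnion_isClosed
  let C : ℕ → Set E := fun k => T k ∩ Metric.closedBall 0 k
  have hCU : ⋃ k, C k = W := by
    refine subset_antisymm (iUnion_subset fun k => inter_subset_left.trans (hTW k)) fun x hx => ?_
    rw [← hTU] at hx
    obtain ⟨k, hk⟩ := mem_iUnion.1 hx
    obtain ⟨m, hm⟩ := exists_nat_ge ‖x‖
    refine mem_iUnion.2 ⟨max k m, hTm (le_max_left _ _) hk, ?_⟩
    rw [mem_closedBall_zero_iff]
    exact hm.trans (by exact_mod_cast le_max_right _ _)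
  have hCm : Monotone C := fun k m hkm => inter_subset_inter (hTm hkm)
    (Metric.closedBall_subset_closedBall (by exact_mod_cast hkm))
  rw [← hCU, setLIntegral_iUnion_of_directed _ hCm.directed_le]
  exact iSup_le fun k => hcompact _ ((isCompact_closedBall _ _).inter_left (hTc k))
    (inter_subset_left.trans (hTW k))

/-- For a test function `ψ`, the segment average of `-ψ` is admissible on `U`, and its derivative
along `e` is a difference quotient of `-ψ`. Summation by parts then bounds `∫ (f (x + h • e) - f x)
* ψ x`, and duality recovers the L¹ norm. -/
lemma lintegral_translate_le_directionalTV {U : Set E} (hUo : IsOpen U) (hU : Convex ℝ U)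
    {f : E → ℝ} (hf : IntegrableOn f U μ) {e : E} {h : ℝ} (hh : 0 < h) :
    ∫⁻ x in {x | x ∈ U ∧ x + h • e ∈ U}, ‖f (x + h • e) - f x‖ₑ ∂μ ≤
      ENNReal.ofReal h * directionalTV μ f U e := by
  rcases eq_or_ne (directionalTV μ f U e) ∞ with hT | hT
  · rw [hT, ENNReal.mul_top (by simpa using hh)]; exact le_top
  have hWo : IsOpen {x | x ∈ U ∧ x + h • e ∈ U} :=
    hUo.inter (hUo.preimage (continuous_add_const (h • e)))
  have hF : IntegrableOn (fun x => f (x + h • e) - f x) {x | x ∈ U ∧ x + h • e ∈ U} μ := by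
    have hfi : Integrable (U.indicator f) μ := (integrable_indicator_iff hUo.measurableSet).2 hf
    refine IntegrableOn.congr_fun (f := fun x => U.indicator f (x + h • e) - U.indicator f x)
      ((hfi.comp_add_right (h • e)).sub hfi).integrableOn (fun x hx => ?_) hWo.measurableSet
    simp [hx.1, hx.2]
  rw [← ENNReal.ofReal_toReal hT, ← ENNReal.ofReal_mul hh.le]
  refine lintegral_enorm_le_of_forall_isUnitTestFunction μ hWo hF fun ψ hψ => ?_
  obtain ⟨Ψ, hΨ, hΨd⟩ := hψ.neg.exists_average hU hh subset_rfl
  have hle : ∫ x in U, f x * fderiv ℝ Ψ x e ∂μ ≤ (directionalTV μ f U e).toReal := by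
    rw [← ENNReal.ofReal_le_iff_le_toReal hT]
    exact le_iSup (fun φ : {φ : E → ℝ // IsUnitTestFunction U φ} =>
      ENNReal.ofReal (∫ x in U, f x * fderiv ℝ φ.1 x e ∂μ)) ⟨Ψ, hΨ⟩
  have heq : ∫ x in U, f x * fderiv ℝ Ψ x e ∂μ =
      h⁻¹ * ∫ x in {x | x ∈ U ∧ x + h • e ∈ U}, (f (x + h • e) - f x) * ψ x ∂μ := by
    have := hψ.neg.setIntegral_mul_sub_translate μ hUo.measurableSet hf
    simp only [Pi.neg_apply, mul_neg, integral_neg, neg_neg] at this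
    rw [← this, ← integral_const_mul]
    refine integral_congr_ae (ae_of_all _ fun x => ?_)
    simp only [hΨd, Pi.neg_apply]
    ring
  rw [heq, inv_mul_le_iff₀ hh] at hle
  exact hle

end DirectionalVariation

/-! ### Splitting the anisotropic variation into coordinate directions. -/

section AnisotropicTV

variable {d : ℕ}

lemma IsUnitTestFunction.integrableOn_mul_fderiv {E : Type*} [NormedAddCommGroup E]
    [NormedSpace ℝ E] [MeasurableSpace E] [BorelSpace E] {μ : Measure E} {U : Set E} {f φ : E → ℝ}
    (hφ : IsUnitTestFunction U φ) (hf : IntegrableOn f U μ) (e : E) :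
    IntegrableOn (fun x => f x * fderiv ℝ φ x e) U μ := by
  obtain ⟨C, hC⟩ := hφ.exists_fderiv_bound
  refine hf.mul_bdd (c := C * ‖e‖)
    (hφ.continuous_fderiv_apply e).measurable.aestronglyMeasurable (ae_of_all _ fun x => ?_)
  exact ((fderiv ℝ φ x).le_opNorm e).trans (by gcongr; exact hC x)

lemma anisotropicTV_le_sum_directionalTV {U : Opens (Fin d → ℝ)} {f : (Fin d → ℝ) → ℝ}
    (hf : IntegrableOn f U volume) :
    anisotropicTV f U ≤ ∑ j, directionalTV volume f U (Pi.single j 1) := by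
  refine iSup_le ?_
  rintro ⟨φ, hφ⟩
  -- The bound is assumed only on `U`; elsewhere `φ` vanishes.
  have hφ' : ∀ x, ‖φ x‖ ≤ 1 := fun x => by
    by_cases hx : x ∈ U
    · exact hφ x hx
    · rw [image_eq_zero_of_notMem_tsupport fun h => hx (φ.tsupport_subset h)]; simp
  have hunit : ∀ j, IsUnitTestFunction (U : Set (Fin d → ℝ)) fun x => φ x j := fun j => by
    have hsub : tsupport (fun x => φ x j) ⊆ tsupport φ :=
      closure_mono fun x hx h0 => hx (by simp [h0])
    exact ⟨contDiff_pi.1 φ.contDiff j,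
      φ.hasCompactSupport.of_isClosed_subset (isClosed_tsupport _) hsub,
      hsub.trans φ.tsupport_subset, fun x => (norm_le_pi_norm (φ x) j).trans (hφ' x)⟩
  have heq : ∫ x in (U : Set (Fin d → ℝ)), f x * divergence φ x =
      ∑ j, ∫ x in (U : Set (Fin d → ℝ)), f x * fderiv ℝ (fun z => φ z j) x (Pi.single j 1) := by
    rw [← integral_finsetSum _ fun j _ => (hunit j).integrableOn_mul_fderiv hf _]
    simp only [divergence, Finset.mul_sum]
  rw [heq]
  refine (Finset.le_sum_of_subadditive ENNReal.ofReal ENNReal.ofReal_zero.le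
    (fun _ _ => ENNReal.ofReal_add_le) _ _).trans (Finset.sum_le_sum fun j _ => ?_)
  exact le_iSup (fun φ : {φ : (Fin d → ℝ) → ℝ // IsUnitTestFunction U φ} =>
    ENNReal.ofReal (∫ x in U, f x * fderiv ℝ φ.1 x (Pi.single j 1))) ⟨_, hunit j⟩

/-- Scalar test functions chosen separately for each coordinate assemble into an admissible field,
because its sup norm is the largest of theirs. -/
lemma sum_directionalTV_le_anisotropicTV {U : Opens (Fin d → ℝ)} {f : (Fin d → ℝ) → ℝ}
    (hf : IntegrableOn f U volume) :
    ∑ j, directionalTV volume f U (Pi.single j 1) ≤ anisotropicTV f U := by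
  let T := {φ : (Fin d → ℝ) → ℝ // IsUnitTestFunction U φ}
  have : Nonempty T := ⟨⟨0, .zero⟩⟩
  let I : Fin d → T → ℝ := fun j φ => ∫ x in U, f x * fderiv ℝ φ.1 x (Pi.single j 1)
  have hcomp : ∀ j, directionalTV volume f U (Pi.single j 1) =
      ⨆ Φ : Fin d → T, ENNReal.ofReal (I j (Φ j)) := fun j =>
    (Function.Surjective.iSup_comp (f := fun Φ : Fin d → T => Φ j) (fun φ => ⟨fun _ => φ, rfl⟩)
      fun φ : T => ENNReal.ofReal (I j φ)).symm
  simp only [hcomp]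
  rw [ENNReal.finsetSum_iSup]
  swap
  -- Exchanging sum and supremum needs a directed family: the better entry is taken in each
  -- coordinate.
  · intro Φ Ψ
    refine ⟨fun j => if ENNReal.ofReal (I j (Φ j)) ≤ ENNReal.ofReal (I j (Ψ j)) then Ψ j else Φ j,
      fun j => ?_⟩
    simp only
    split_ifs with h
    · exact ⟨h, le_rfl⟩
    · exact ⟨le_rfl, (not_le.1 h).le⟩
  refine iSup_le fun Φ => ?_
  -- Replacing entries with negative integral by `0` makes `ENNReal.ofReal` additive on the sum.
  let Ψ : Fin d → T := fun j => if 0 ≤ I j (Φ j) then Φ j else ⟨0, .zero⟩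
  have hΨ : ∀ j, 0 ≤ I j (Ψ j) ∧ ENNReal.ofReal (I j (Φ j)) ≤ ENNReal.ofReal (I j (Ψ j)) := by
    intro j
    by_cases h : 0 ≤ I j (Φ j)
    · simp [Ψ, h]
    · simp [Ψ, h, I, ENNReal.ofReal_of_nonpos (not_le.1 h).le]
  refine (Finset.sum_le_sum fun j _ => (hΨ j).2).trans ?_
  rw [← ENNReal.ofReal_sum_of_nonneg fun j _ => (hΨ j).1]
  have hsub : tsupport (fun x j => (Ψ j).1 x) ⊆ ⋃ j, tsupport (Ψ j).1 := by
    refine closure_minimal (fun x hx => ?_) (isClosed_iUnion_of_finite fun j => isClosed_tsupport _)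
    obtain ⟨j, hj⟩ := Function.ne_iff.1 hx
    exact mem_iUnion.2 ⟨j, subset_tsupport _ hj⟩
  let φ : 𝓓(U, Fin d → ℝ) :=
    ⟨fun x j => (Ψ j).1 x, contDiff_pi.2 fun j => (Ψ j).2.contDiff,
      (isCompact_iUnion fun j => (Ψ j).2.hasCompactSupport.isCompact).of_isClosed_subset
        (isClosed_tsupport _) hsub,
      hsub.trans (iUnion_subset fun j => (Ψ j).2.tsupport_subset)⟩
  have hφ : ∀ x ∈ U, ‖φ x‖ ≤ 1 := fun x _ =>
    (pi_norm_le_iff_of_nonneg zero_le_one).2 fun j => (Ψ j).2.abs_le_one x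
  have heq : ∑ j, I j (Ψ j) = ∫ x in (U : Set (Fin d → ℝ)), f x * divergence φ x := by
    rw [← integral_finsetSum _ fun j _ => (Ψ j).2.integrableOn_mul_fderiv hf _]
    simp only [divergence, Finset.mul_sum]
    rfl
  rw [heq]
  exact le_iSup (fun φ : {φ : 𝓓(U, Fin d → ℝ) // ∀ x ∈ U, ‖φ x‖ ≤ 1} =>
    ENNReal.ofReal (∫ x in (U : Set (Fin d → ℝ)), f x * divergence φ.1 x)) ⟨φ, hφ⟩

end AnisotropicTV

/-! ### Slicing by lines and integrating over them. -/

section Slices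

variable {n : ℕ}

lemma insertNth_eq_add_smul_single (j : Fin (n + 1)) (t : ℝ) (y : Fin n → ℝ) :
    (j.insertNth t y : Fin (n + 1) → ℝ) = j.insertNth 0 y + t • Pi.single j 1 := by
  ext i
  refine j.succAboveCases ?_ (fun i => ?_) i <;> simp

lemma insertNth_add_smul_single (j : Fin (n + 1)) (t h : ℝ) (y : Fin n → ℝ) :
    (j.insertNth t y : Fin (n + 1) → ℝ) + h • Pi.single j 1 = j.insertNth (t + h) y := by
  rw [insertNth_eq_add_smul_single j t, insertNth_eq_add_smul_single j (t + h), add_smul, add_assoc]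

lemma continuous_insertNth_left (j : Fin (n + 1)) (y : Fin n → ℝ) :
    Continuous fun t : ℝ => (j.insertNth t y : Fin (n + 1) → ℝ) := by
  rw [funext fun t => insertNth_eq_add_smul_single j t y]
  fun_prop

lemma continuous_insertNth_right (j : Fin (n + 1)) (t : ℝ) :
    Continuous fun y : Fin n → ℝ => (j.insertNth t y : Fin (n + 1) → ℝ) := by
  refine continuous_pi fun i => ?_
  refine j.succAboveCases ?_ (fun i => ?_) i <;> simp <;> fun_prop

lemma isOpen_coordProj {U : Set (Fin (n + 1) → ℝ)} (hU : IsOpen U) (j : Fin (n + 1)) :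
    IsOpen (coordProj U j) := by
  have : coordProj U j = ⋃ t : ℝ, {y | (j.insertNth t y : Fin (n + 1) → ℝ) ∈ U} := by
    ext y; simp [coordProj, coordSlice, Set.Nonempty]
  rw [this]
  exact isOpen_iUnion fun t => hU.preimage (continuous_insertNth_right j t)

lemma coordSlice_eq_Ioo {U : Set (Fin (n + 1) → ℝ)} (hU : IsOpen U)
    (hb : Bornology.IsBounded U) (hc : Convex ℝ U) {j : Fin (n + 1)} {y : Fin n → ℝ}
    (hy : y ∈ coordProj U j) :
    coordSlice U j y = Ioo (sInf (coordSlice U j y)) (sSup (coordSlice U j y)) := by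
  set S := coordSlice U j y with hS
  have hSo : IsOpen S := hU.preimage (continuous_insertNth_left j y)
  have hSc : Convex ℝ S := by
    intro s hs t ht a b ha hb' hab
    have := hc hs ht ha hb' hab
    have h1 : a • (j.insertNth s y : Fin (n + 1) → ℝ) + b • j.insertNth t y =
        j.insertNth (a • s + b • t) y := by
      ext i
      refine j.succAboveCases ?_ (fun i => ?_) i
      · simp
      · simp [← add_mul, hab]
    rwa [h1] at this
  have hSb : Bornology.IsBounded S := by
    have := (LipschitzWith.eval (α := fun _ : Fin (n + 1) => ℝ) j).isBounded_image hb
    refine this.subset fun t ht => ⟨_, ht, by simp⟩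
  have hne : S.Nonempty := hy
  -- Openness keeps the slice from attaining its bounds; connectedness gives the other inclusion.
  refine subset_antisymm (fun t ht => ?_)
    (IsConnected.Ioo_csInf_csSup_subset ⟨hne, hSc.isPreconnected⟩ hSb.bddBelow hSb.bddAbove)
  obtain ⟨ε, hε, hball⟩ := Metric.isOpen_iff.1 hSo t ht
  have h1 : t - ε / 2 ∈ S := hball (by simp [abs_of_pos hε, hε])
  have h2 : t + ε / 2 ∈ S := hball (by simp [abs_of_pos hε, hε])
  exact ⟨(csInf_le hSb.bddBelow h1).trans_lt (by linarith),
    (le_csSup hSb.bddAbove h2).trans_lt' (by linarith)⟩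

lemma measurePreserving_insertNth (j : Fin (n + 1)) :
    MeasurePreserving (fun p : (Fin n → ℝ) × ℝ => (j.insertNth p.2 p.1 : Fin (n + 1) → ℝ))
      (volume.prod volume) volume :=
  ((volume_preserving_piFinSuccAbove (fun _ : Fin (n + 1) => ℝ) j).symm _).comp
    Measure.measurePreserving_swap

/-- The slice of a difference of translates over `U ∩ (U - h • e_j)` along a line in direction `j`. -/
lemma lintegral_coordSlice_indicator {U : Set (Fin (n + 1) → ℝ)} (hU : IsOpen U)
    (hb : Bornology.IsBounded U) (hc : Convex ℝ U) {j : Fin (n + 1)} {y : Fin n → ℝ}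
    (hy : y ∈ coordProj U j) (f : (Fin (n + 1) → ℝ) → ℝ) {h : ℝ} (hh : 0 < h) :
    ∫⁻ t, {x | x ∈ U ∧ x + h • Pi.single j 1 ∈ U}.indicator
        (fun x => ‖f (x + h • Pi.single j 1) - f x‖ₑ) (j.insertNth t y) =
      ∫⁻ t in Ioo (sInf (coordSlice U j y)) (sSup (coordSlice U j y) - h),
        ‖f (j.insertNth (t + h) y) - f (j.insertNth t y)‖ₑ := by
  rw [← lintegral_indicator measurableSet_Ioo]
  refine lintegral_congr fun t => ?_
  have hmem : ∀ s : ℝ, (j.insertNth s y : Fin (n + 1) → ℝ) ∈ U ↔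
      s ∈ Ioo (sInf (coordSlice U j y)) (sSup (coordSlice U j y)) := fun s => by
    rw [← coordSlice_eq_Ioo hU hb hc hy]; rfl
  simp only [indicator, mem_ofPred_eq, insertNth_add_smul_single]
  congr 1
  apply propext
  rw [insertNth_add_smul_single, hmem, hmem]
  constructor
  · rintro ⟨h1, h2⟩; exact ⟨h1.1, by linarith [h2.2]⟩
  · rintro ⟨h1, h2⟩; exact ⟨⟨h1, by linarith⟩, ⟨by linarith, by linarith⟩⟩

lemma ae_integrableOn_insertNth {U : Set (Fin (n + 1) → ℝ)} (hU : IsOpen U)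
    (hb : Bornology.IsBounded U) (hc : Convex ℝ U) (j : Fin (n + 1)) {f : (Fin (n + 1) → ℝ) → ℝ}
    (hf : IntegrableOn f U volume) :
    ∀ᵐ y, y ∈ coordProj U j → IntegrableOn (fun t => f (j.insertNth t y))
      (Ioo (sInf (coordSlice U j y)) (sSup (coordSlice U j y))) := by
  have hfi : Integrable (U.indicator f) volume := (integrable_indicator_iff hU.measurableSet).2 hf
  have h1 := ((measurePreserving_insertNth j).integrable_comp_of_integrable hfi).prod_right_ae
  filter_upwards [h1] with y hy hyU
  rw [← integrable_indicator_iff measurableSet_Ioo, ← coordSlice_eq_Ioo hU hb hc hyU]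
  exact hy

/-- On almost every line, the essential variation is the limit inferior of the integrated
difference quotients, each of which it dominates. Integrating over the lines recovers the
directional total variation. -/
lemma aemeasurable_lineVariation_and_directionalTV_eq {U : Set (Fin (n + 1) → ℝ)} (hU : IsOpen U)
    (hb : Bornology.IsBounded U) (hc : Convex ℝ U) (j : Fin (n + 1)) {f : (Fin (n + 1) → ℝ) → ℝ}
    (hf : IntegrableOn f U volume) :
    AEMeasurable (lineVariation f U j) (volume.restrict (coordProj U j)) ∧
      directionalTV volume f U (Pi.single j 1) = ∫⁻ y in coordProj U j, lineVariation f U j y := by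
  set e : Fin (n + 1) → ℝ := Pi.single j 1 with he
  set P := coordProj U j with hP
  have hPm : MeasurableSet P := (isOpen_coordProj hU j).measurableSet
  -- Steps along a sequence, so that the limit inferior is over a countable family and stays
  -- measurable.
  let h : ℕ → ℝ := fun k => 1 / ((k : ℝ) + 1)
  have hpos : ∀ k, 0 < h k := fun k => by positivity
  have hlim : Tendsto h atTop (𝓝 0) := tendsto_one_div_add_atTop_nhds_zero_nat
  let W : ℕ → Set (Fin (n + 1) → ℝ) := fun k => {x | x ∈ U ∧ x + h k • e ∈ U}
  have hWm : ∀ k, MeasurableSet (W k) := fun k =>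
    (hU.inter (hU.preimage (continuous_add_const (h k • e)))).measurableSet
  let G : ℕ → (Fin (n + 1) → ℝ) → ℝ≥0∞ := fun k =>
    (W k).indicator fun x => ‖f (x + h k • e) - f x‖ₑ
  have hfi : Integrable (U.indicator f) volume := (integrable_indicator_iff hU.measurableSet).2 hf
  have hGm : ∀ k, AEMeasurable (G k) volume := by
    intro k
    have hm : AEMeasurable (fun x => ‖U.indicator f (x + h k • e) - U.indicator f x‖ₑ) volume :=
      ((hfi.comp_add_right (h k • e)).sub hfi).aestronglyMeasurable.enorm
    refine (hm.indicator (hWm k)).congr (ae_of_all _ fun x => ?_)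
    by_cases hx : x ∈ W k
    · simp only [G, indicator_of_mem hx, indicator_of_mem hx.1, indicator_of_mem hx.2]
    · simp only [G, indicator_of_notMem hx]
  have hmp := measurePreserving_insertNth j
  have hGm' : ∀ k, AEMeasurable (fun p : (Fin n → ℝ) × ℝ => G k (j.insertNth p.2 p.1))
      (volume.prod volume) := fun k => (hGm k).comp_quasiMeasurePreserving hmp.quasiMeasurePreserving
  let q : ℕ → (Fin n → ℝ) → ℝ≥0∞ := fun k y =>
    (ENNReal.ofReal (h k))⁻¹ * ∫⁻ t, G k (j.insertNth t y)
  have hqm : ∀ k, AEMeasurable (q k) volume := fun k =>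
    (hGm' k).lintegral_prod_right'.const_mul _
  have hqint : ∀ k, ∫⁻ y in P, q k y = (ENNReal.ofReal (h k))⁻¹ *
      ∫⁻ x in W k, ‖f (x + h k • e) - f x‖ₑ := by
    intro k
    have hfin : (ENNReal.ofReal (h k))⁻¹ ≠ ∞ := by simpa using hpos k
    -- A line over `y` outside `P` misses `U`, so Tonelli may be applied on the whole space.
    have h0 : ∫⁻ y in P, q k y = ∫⁻ y, q k y := by
      refine setLIntegral_eq_of_support_subset fun y hy => ?_
      by_contra hyP
      refine hy ?_
      have : ∀ t : ℝ, G k (j.insertNth t y) = 0 := fun t =>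
        indicator_of_notMem (fun ht => hyP ⟨t, ht.1⟩) _
      simp [q, this]
    rw [h0, lintegral_const_mul' _ _ hfin, ← lintegral_indicator (hWm k)]
    congr 1
    change _ = ∫⁻ x, G k x
    rw [← hmp.map_eq, lintegral_map' (by rw [hmp.map_eq]; exact hGm k) hmp.measurable.aemeasurable,
      lintegral_prod _ (hGm' k)]
  have hle : ∀ᵐ y ∂volume.restrict P, ∀ k, q k y ≤ lineVariation f U j y := by
    rw [ae_restrict_iff' hPm]
    filter_upwards [ae_integrableOn_insertNth hU hb hc j hf] with y hy hyP k
    simp only [q, G, W, he]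
    rw [lintegral_coordSlice_indicator hU hb hc hyP f (hpos k)]
    exact (ENNReal.inv_mul_le_iff (by simpa using hpos k) ENNReal.ofReal_ne_top).2
      (lintegral_translate_le_essVariation (hpos k) (hy hyP))
  have hge : ∀ᵐ y ∂volume.restrict P, lineVariation f U j y ≤ liminf (fun k => q k y) atTop := by
    rw [ae_restrict_iff' hPm]
    filter_upwards [ae_integrableOn_insertNth hU hb hc j hf] with y hy hyP
    simp only [q, G, W, he]
    simp only [lintegral_coordSlice_indicator hU hb hc hyP f (hpos _)]
    exact essVariation_le_liminf (hy hyP) hpos hlim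
  have heq : lineVariation f U j =ᵐ[volume.restrict P] fun y => liminf (fun k => q k y) atTop := by
    filter_upwards [hle, hge] with y h1 h2
    refine le_antisymm h2 ?_
    refine (liminf_le_liminf (Eventually.of_forall h1)).trans_eq ?_
    simp
  have hqlim : AEMeasurable (fun y => liminf (fun k => q k y) atTop) volume := by
    simp only [liminf_eq_iSup_iInf_of_nat']
    exact AEMeasurable.iSup fun m => AEMeasurable.iInf fun k => hqm (k + m)
  refine ⟨hqlim.restrict.congr heq.symm, le_antisymm ?_ ?_⟩
  · refine (directionalTV_le_liminf volume hU hf hpos hlim).trans ?_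
    simp only [W] at hqint
    simp only [← hqint]
    refine (liminf_le_liminf (Eventually.of_forall fun k => ?_)).trans_eq
      (liminf_const (∫⁻ y in P, lineVariation f U j y))
    exact lintegral_mono_ae (hle.mono fun y hy => hy k)
  -- This inequality is Fatou's lemma followed by the bound of each difference quotient by
  -- `directionalTV`.
  · rw [lintegral_congr_ae heq]
    refine (lintegral_liminf_le' fun k => (hqm k).restrict).trans ?_
    simp only [hqint]
    refine (liminf_le_liminf (Eventually.of_forall fun k => ?_)).trans_eq
      (liminf_const (directionalTV volume f U e))
    exact (ENNReal.inv_mul_le_iff (by simpa using hpos k) ENNReal.ofReal_ne_top).2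
      (lintegral_translate_le_directionalTV volume hU hc hf (hpos k))

end Slices

/-- The condition `d ≥ 1` is encoded as `d = n + 1`, and Lebesgue measurability on the projection as
almost everywhere measurability for the restricted measure. -/
theorem theorem1 (n : ℕ) (U : Opens (Fin (n + 1) → ℝ))
    (hbdd : Bornology.IsBounded (U : Set (Fin (n + 1) → ℝ)))
    (hconv : Convex ℝ (U : Set (Fin (n + 1) → ℝ)))
    (f : (Fin (n + 1) → ℝ) → ℝ) (hf : IsBV f U) :
    (∀ j : Fin (n + 1), AEMeasurable (lineVariation f (U : Set (Fin (n + 1) → ℝ)) j)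
      (volume.restrict (coordProj (U : Set (Fin (n + 1) → ℝ)) j))) ∧
    anisotropicTV f U =
      ∑ j : Fin (n + 1), ∫⁻ y in coordProj (U : Set (Fin (n + 1) → ℝ)) j,
        lineVariation f (U : Set (Fin (n + 1) → ℝ)) j y := by
  have key := fun j => aemeasurable_lineVariation_and_directionalTV_eq U.isOpen hbdd hconv j hf.1
  refine ⟨fun j => (key j).1, ?_⟩
  rw [le_antisymm (anisotropicTV_le_sum_directionalTV hf.1)
    (sum_directionalTV_le_anisotropicTV hf.1)]
  exact Finset.sum_congr rfl fun j _ => (key j).2
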